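/- For real $a>1/2$ and real $s$ let $$\gamma=\frac{\left|\Gamma(a-is/2)\right|^2}{\Gamma(a)\,\Gamma(a-1/2)\,\Gamma(1/2)}$$ be the normalization constant of the Pearson IV density $f(x)=\gamma\,e^{s\arctan x}(1+x^2)^{-a}$, $x\in\mathbb{R}$, where $\Gamma$ is the (complex) gamma function. Let $a\ge 1$ and $s\ge 0$. Then $\gamma^-\le\gamma\le\gamma^+$, where $$\gamma^*=\frac{(a-\tfrac12)\left(1+\left(\tfrac{s}{2a}\right)^2\right)^{a-1/2}e^{-s\arctan\left(\frac{s}{2a}\right)}}{\sqrt{\pi/e}\,\left(1+\tfrac1{2a}\right)^a\sqrt a},$$ $$\gamma^+=\gamma^*\cdot\frac{\left(1+\frac{3}{2\pi^2\sqrt{a^2+(s/2)^2}}\right)^2}{\sqrt{1+\frac{1}{6a}}\,\sqrt{1+\frac{1}{6(a+1/2)}}},\qquad \gamma^-=\gamma^*\cdot\frac{\left(1-\frac{3}{2\pi^2\sqrt{a^2+(s/2)^2}}\right)^2}{\sqrt{1+\frac{0.177}{a}}\,\sqrt{1+\frac{0.177}{a+1/2}}}.$$ -/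

import Mathlib

namespace PearsonIV

/-- The normalization constant of the Pearson IV density
`γ * exp (s * arctan x) / (1 + x ^ 2) ^ a`. -/
noncomputable def gammaConst (a s : ℝ) : ℝ :=
  ‖Complex.Gamma ((a : ℂ) - Complex.I * (s : ℂ) / 2)‖ ^ 2 /
    (Real.Gamma a * Real.Gamma (a - 1 / 2) * Real.Gamma (1 / 2))

/-- The common factor `γ*` of both bounds. The powers are real powers. -/
noncomputable def gammaStar (a s : ℝ) : ℝ :=
  ((a - 1 / 2) * (1 + (s / (2 * a)) ^ 2) ^ (a - 1 / 2 : ℝ)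
      * Real.exp (-(s * Real.arctan (s / (2 * a))))) /
    (√(Real.pi / Real.exp 1) * (1 + 1 / (2 * a)) ^ (a : ℝ) * √a)

/-- The upper bound `γ⁺`. -/
noncomputable def gammaPlus (a s : ℝ) : ℝ :=
  gammaStar a s *
    ((1 + 3 / (2 * Real.pi ^ 2 * √(a ^ 2 + (s / 2) ^ 2))) ^ 2 /
      (√(1 + 1 / (6 * a)) * √(1 + 1 / (6 * (a + 1 / 2)))))

/-- The lower bound `γ⁻`. -/
noncomputable def gammaMinus (a s : ℝ) : ℝ :=
  gammaStar a s *
    ((1 - 3 / (2 * Real.pi ^ 2 * √(a ^ 2 + (s / 2) ^ 2))) ^ 2 /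
      (√(1 + 0.177 / a) * √(1 + 0.177 / (a + 1 / 2))))

end PearsonIV

/-! Write each Gamma factor as its Stirling approximation times the exponential of a remainder, the
Binet function. After replacing `Γ(a - 1/2)` by `Γ(a + 1/2) / (a - 1/2)`, the Stirling parts
multiply to exactly `γ*` (`gammaConst_eq`). What is left is `exp (2 B(z) - B(a) - B(a + 1/2))`, with
`B = binetRe` and `z = a - is/2`, so only bounds on `B` are needed.

`B` vanishes along `z + n`, and `B(z) - B(z + 1)` is elementary. Any `G` that tends to `0` along the
same shifts and whose differences dominate those of `B` therefore dominates `B`. An arctangent `G`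
gives `|B(z)| ≤ (π/23)/‖z‖` (`abs_binetRe_le`); on the real axis `log (1 + c/x) / 2` bounds `B` from
below with `c = 1/6` and from above with `c = 0.177`. -/

namespace PearsonIV

open Filter Topology

/-! ### The Binet function: its differences and its decay along `z + n`. -/

/-- The real part of the Binet function: the logarithm of the ratio of `‖Γ z‖` to the modulus of
its Stirling approximation `√(2π) z ^ (z - 1/2) e ^ (-z)`. -/
noncomputable def binetRe (z : ℂ) : ℝ :=
  Real.log ‖Complex.Gamma z‖ - ((z - 1 / 2) * Complex.log z - z).re - Real.log (2 * Real.pi) / 2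

theorem binetRe_sub_add_one {z : ℂ} (hz : 0 < z.re) :
    binetRe z - binetRe (z + 1) =
      ((z + 1 / 2) * (Complex.log (z + 1) - Complex.log z) - 1).re := by
  have hz0 : z ≠ 0 := by rintro rfl; simp at hz
  have h1 : Real.log ‖Complex.Gamma (z + 1)‖ = (Complex.log z).re + Real.log ‖Complex.Gamma z‖ := by
    rw [Complex.Gamma_add_one _ hz0, norm_mul, Real.log_mul (norm_ne_zero_iff.2 hz0)
      (norm_ne_zero_iff.2 (Complex.Gamma_ne_zero_of_re_pos hz)), Complex.log_re]
  rw [binetRe, binetRe, h1]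
  have h2 : ((z + 1 / 2) * (Complex.log (z + 1) - Complex.log z) - 1).re =
      ((z + 1 - 1 / 2) * Complex.log (z + 1) - (z + 1)).re
        - ((z - 1 / 2) * Complex.log z - z).re - (Complex.log z).re := by
    rw [← Complex.sub_re, ← Complex.sub_re]
    congr 1
    ring
  rw [h2]
  linarith

theorem Gamma_add_natCast {z : ℂ} (hz : 0 < z.re) (n : ℕ) :
    Complex.Gamma (z + n) = (∏ j ∈ Finset.range n, (z + j)) * Complex.Gamma z := by
  induction n with
  | zero => simp
  | succ n ih =>
    have h : z + n ≠ 0 := by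
      intro h
      have := congrArg Complex.re h
      simp at this
      have : (0 : ℝ) ≤ n := n.cast_nonneg
      linarith
    rw [Finset.prod_range_succ, Nat.cast_succ, ← add_assoc, Complex.Gamma_add_one _ h, ih]
    ring

theorem log_norm_Gamma_add_natCast {z : ℂ} (hz : 0 < z.re) {n : ℕ} (hn : n ≠ 0) :
    Real.log ‖Complex.Gamma (z + (n + 1))‖ =
      Real.log ‖Complex.Gamma z‖ - Real.log ‖Complex.GammaSeq z n‖ + z.re * Real.log n
        + Real.log n.factorial := by
  have hn' : (0 : ℝ) < n := by positivity
  have hp : (∏ j ∈ Finset.range (n + 1), (z + j)) ≠ 0 := by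
    refine Finset.prod_ne_zero_iff.2 fun j _ h => ?_
    have := congrArg Complex.re h
    simp at this
    have : (0 : ℝ) ≤ j := j.cast_nonneg
    linarith
  have hG := Complex.Gamma_ne_zero_of_re_pos hz
  have h1 := Gamma_add_natCast hz (n + 1)
  push_cast at h1
  have hpow : ‖(n : ℂ) ^ z‖ = (n : ℝ) ^ z.re := by
    have := Complex.norm_cpow_eq_rpow_re_of_pos hn' z
    simpa using this
  rw [h1, norm_mul, Real.log_mul (norm_ne_zero_iff.2 hp) (norm_ne_zero_iff.2 hG),
    Complex.GammaSeq, norm_div, norm_mul, hpow, Complex.norm_natCast,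
    Real.log_div (by positivity) (norm_ne_zero_iff.2 hp), Real.log_mul (by positivity)
    (by positivity), Real.log_rpow hn']
  ring

theorem tendsto_add_half_mul_log {z : ℂ} :
    Tendsto (fun n : ℕ => (z + n + 1 / 2) * Complex.log (1 + (z + 1) / n)) atTop (𝓝 (z + 1)) := by
  have h0 : Tendsto (fun n : ℕ => (z + 1) / (n : ℂ)) atTop (𝓝 0) :=
    tendsto_const_div_atTop_nhds_zero_nat (z + 1)
  have h1 : Tendsto (fun n : ℕ => (n : ℂ) * Complex.log (1 + (z + 1) / n)) atTop (𝓝 (z + 1)) := by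
    apply Complex.tendsto_nat_mul_log_one_add_of_tendsto
    refine tendsto_const_nhds.congr' ?_
    filter_upwards [eventually_ne_atTop 0] with n hn
    have : (n : ℂ) ≠ 0 := by exact_mod_cast hn
    field_simp
  have h2 : Tendsto (fun n : ℕ => Complex.log (1 + (z + 1) / n)) atTop (𝓝 0) := by
    have h3 : Tendsto (fun n : ℕ => 1 + (z + 1) / (n : ℂ)) atTop (𝓝 1) := by
      simpa using h0.const_add 1
    have := (continuousAt_clog (x := 1) (by simp)).tendsto.comp h3
    simpa [Function.comp_def] using this
  have := h1.add (h2.const_mul (z + 1 / 2))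
  simp only [mul_zero, add_zero] at this
  exact this.congr fun n => by ring

/-- Each of the three brackets tends to `0`: by Euler's limit for `Γ`, by Stirling's formula for
`n!`, and by `n log (1 + w/n) → w`. -/
theorem binetRe_add_natCast_eq {z : ℂ} (hz : 0 < z.re) {n : ℕ} (hn : n ≠ 0) :
    binetRe (z + (n + 1)) =
      (Real.log ‖Complex.Gamma z‖ - Real.log ‖Complex.GammaSeq z n‖)
        + (Real.log (Stirling.stirlingSeq n) - Real.log Real.pi / 2)
        + ((z + 1).re - ((z + n + 1 / 2) * Complex.log (1 + (z + 1) / n)).re) := by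
  have hn' : (0 : ℝ) < n := by positivity
  have hnC : (n : ℂ) ≠ 0 := by exact_mod_cast hn
  have h1 : Complex.log (z + (n + 1)) = Real.log n + Complex.log (1 + (z + 1) / n) := by
    rw [← Complex.log_ofReal_mul hn']
    · congr 1
      push_cast
      field_simp
      ring
    · intro h
      have h2 : (n : ℂ) * (1 + (z + 1) / n) = 0 := by rw [h, mul_zero]
      have h3 : (n : ℂ) + z + 1 = 0 := by
        rw [← h2]; field_simp
        ring
      have := congrArg Complex.re h3
      simp at this
      linarith
  have h2 : ((z + (n + 1) - 1 / 2) * Complex.log (z + (n + 1)) - (z + (n + 1))).re =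
      (z.re + n + 1 / 2) * Real.log n + ((z + n + 1 / 2) * Complex.log (1 + (z + 1) / n)).re
        - (z.re + n + 1) := by
    have : (z + (n + 1) - 1 / 2) * Complex.log (z + (n + 1)) - (z + (n + 1)) =
      ((z + n + 1 / 2) * (Real.log n : ℝ)) + ((z + n + 1 / 2) * Complex.log (1 + (z + 1) / n))
        - (z + n + 1) := by
      rw [h1]; ring
    rw [this, Complex.sub_re, Complex.add_re, Complex.re_mul_ofReal]
    simp
  rw [binetRe, h2, log_norm_Gamma_add_natCast hz hn, Stirling.log_stirlingSeq_formula,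
    Real.log_div hn'.ne' (Real.exp_pos 1).ne', Real.log_exp,
    Real.log_mul two_ne_zero hn'.ne', Real.log_mul two_ne_zero Real.pi_pos.ne']
  simp only [Complex.add_re, Complex.one_re]
  ring

theorem tendsto_binetRe_add_natCast {z : ℂ} (hz : 0 < z.re) :
    Tendsto (fun n : ℕ => binetRe (z + n)) atTop (𝓝 0) := by
  -- `GammaSeq z n` has the `n + 1` factors `z, …, z + n`, so it describes `Γ (z + n + 1)`.
  refine (tendsto_add_atTop_iff_nat 1).1 ?_
  have hG : Tendsto (fun n => Real.log ‖Complex.Gamma z‖ - Real.log ‖Complex.GammaSeq z n‖)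
      atTop (𝓝 0) := by
    have := ((Complex.GammaSeq_tendsto_Gamma z).norm.log
      (norm_ne_zero_iff.2 (Complex.Gamma_ne_zero_of_re_pos hz))).const_sub
        (Real.log ‖Complex.Gamma z‖)
    simpa using this
  have hS : Tendsto (fun n => Real.log (Stirling.stirlingSeq n) - Real.log Real.pi / 2)
      atTop (𝓝 0) := by
    have := (Stirling.tendsto_stirlingSeq_sqrt_pi.log (by positivity)).sub_const
      (Real.log Real.pi / 2)
    rwa [Real.log_sqrt Real.pi_pos.le, sub_self] at this
  have hL : Tendsto (fun n : ℕ => (z + 1).re -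
      ((z + n + 1 / 2) * Complex.log (1 + (z + 1) / n)).re) atTop (𝓝 0) := by
    have := ((Complex.continuous_re.tendsto _).comp
      (tendsto_add_half_mul_log (z := z))).const_sub (z + 1).re
    simpa [Function.comp_def] using this
  have := (hG.add hS).add hL
  simp only [add_zero] at this
  refine this.congr' ?_
  filter_upwards [eventually_ne_atTop 0] with n hn
  rw [Nat.cast_succ, binetRe_add_natCast_eq hz hn]

/-- Telescoping comparison: a sequence tending to `0` whose successive differences are dominated
by those of another sequence tending to `0` is dominated by the latter. -/
theorem le_of_sub_succ_le {u v : ℕ → ℝ} (hu : Tendsto u atTop (𝓝 0)) (hv : Tendsto v atTop (𝓝 0))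
    (h : ∀ n, u n - u (n + 1) ≤ v n - v (n + 1)) : u 0 ≤ v 0 := by
  have hm : Monotone fun n => u n - v n := monotone_nat_of_le_succ fun n => by
    have := h n
    linarith
  have := hm.ge_of_tendsto (by simpa using hu.sub hv) 0
  linarith

/-! ### The size of one difference in the right half-plane. -/

theorem log_mul_of_re_pos {u v : ℂ} (hu : 0 < u.re) (hv : 0 < v.re) :
    Complex.log (u * v) = Complex.log u + Complex.log v := by
  have hu' := abs_lt.1 (Complex.abs_arg_lt_pi_div_two_iff.2 (Or.inl hu))
  have hv' := abs_lt.1 (Complex.abs_arg_lt_pi_div_two_iff.2 (Or.inl hv))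
  refine Complex.log_mul ?_ ?_ ⟨by linarith, by linarith⟩
  · rintro rfl; simp at hu
  · rintro rfl; simp at hv

theorem hasSum_log_sub_log {w : ℂ} (hw : ‖w‖ < 1) :
    HasSum (fun k : ℕ => 2 * w ^ (2 * k + 1) / (2 * k + 1))
      (Complex.log (1 + w) - Complex.log (1 - w)) := by
  have h := (Complex.hasSum_taylorSeries_log hw).add (Complex.hasSum_taylorSeries_neg_log hw)
  rw [← sub_eq_add_neg] at h
  have hinj : Function.Injective fun k : ℕ => 2 * k + 1 := fun a b hab => by
    simp only at hab; omega
  rw [← hinj.hasSum_iff] at h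
  · refine h.congr_fun ?_
    intro k
    simp only [Function.comp_apply]
    rw [Even.neg_one_pow (n := 2 * k + 1 + 1) (by simp [parity_simps])]
    push_cast
    ring
  · intro m hm
    have hm' : Even m := by
      by_contra ho
      obtain ⟨k, hk⟩ := Nat.not_even_iff_odd.1 ho
      exact hm ⟨k, hk.symm⟩
    rw [Odd.neg_one_pow hm'.add_one]
    ring

theorem norm_sub_le_of_hasSum {w A : ℂ} (hw : ‖w‖ < 1)
    (hA : HasSum (fun k : ℕ => (w ^ 2) ^ k / (2 * k + 1)) A) :
    ‖A - 1‖ ≤ ‖w‖ ^ 2 / (3 * (1 - ‖w‖ ^ 2)) := by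
  have h1 := (hasSum_nat_add_iff' 1).2 hA
  simp only [Finset.range_one, Finset.sum_singleton, pow_zero, Nat.cast_zero, mul_zero, zero_add,
    div_one] at h1
  have hq : ‖w‖ ^ 2 < 1 := by nlinarith [norm_nonneg w]
  have h2 : HasSum (fun k : ℕ => ‖w‖ ^ 2 / 3 * (‖w‖ ^ 2) ^ k) (‖w‖ ^ 2 / 3 * (1 - ‖w‖ ^ 2)⁻¹) :=
    (hasSum_geometric_of_lt_one (by positivity) hq).mul_left _
  have h3 := tsum_of_norm_bounded (f := fun k : ℕ => (w ^ 2) ^ (k + 1) / (2 * ((k + 1 : ℕ) : ℂ) + 1))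
    h2 (fun k => by
      have : ‖(2 * ((k + 1 : ℕ) : ℂ) + 1)‖ = 2 * k + 3 := by
        have : (2 * ((k + 1 : ℕ) : ℂ) + 1) = ((2 * k + 3 : ℕ) : ℂ) := by push_cast; ring
        rw [this, Complex.norm_natCast]
        push_cast; ring
      rw [norm_div, this, norm_pow, norm_pow, pow_succ, div_le_iff₀ (by positivity)]
      have hk : (0 : ℝ) ≤ k := k.cast_nonneg
      have : 0 ≤ (‖w‖ ^ 2) ^ k * ‖w‖ ^ 2 * (2 * k) := by positivity
      nlinarith)
  rw [h1.tsum_eq] at h3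
  refine h3.trans (le_of_eq ?_)
  have : 1 - ‖w‖ ^ 2 ≠ 0 := by linarith
  field_simp

/-- Centre at the midpoint: with `c = z + 1/2` and `w = 1/(2c)`, `z + 1 = c(1 + w)` and `z = c(1 -
w)`, so only the even powers `w^(2k)/(2k+1)` survive. The geometric bound on the tail becomes
`1/(12(‖c‖² - 1/4))`. -/
theorem norm_add_half_mul_log_sub_one_le {z : ℂ} (hz : 0 < z.re) :
    ‖(z + 1 / 2) * (Complex.log (z + 1) - Complex.log z) - 1‖ ≤
      1 / (12 * (z.re * (z.re + 1) + z.im ^ 2)) := by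
  set c : ℂ := z + 1 / 2 with hc
  have hcre : 0 < c.re := by rw [hc]; simp; linarith
  have hc0 : c ≠ 0 := by intro h; rw [h] at hcre; simp at hcre
  have hN : ‖c‖ ^ 2 = z.re * (z.re + 1) + z.im ^ 2 + 1 / 4 := by
    rw [Complex.sq_norm, Complex.normSq_apply, hc]
    simp
    ring
  have hD : 0 < z.re * (z.re + 1) + z.im ^ 2 := by positivity
  set w : ℂ := 1 / (2 * c) with hw
  have hwn : ‖w‖ ^ 2 = 1 / (4 * ‖c‖ ^ 2) := by
    rw [hw, norm_div, norm_mul]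
    simp
    ring
  have hq : ‖w‖ ^ 2 < 1 := by
    rw [hwn, hN, div_lt_one (by positivity)]
    linarith
  have hw1 : ‖w‖ < 1 := by nlinarith [norm_nonneg w]
  have hwre := abs_le.1 (Complex.abs_re_le_norm w)
  have hp : Complex.log (z + 1) = Complex.log (1 + w) + Complex.log c := by
    rw [← log_mul_of_re_pos (by simp; linarith) hcre]
    congr 1
    rw [add_mul, hw]
    field_simp
    rw [hc]
    ring
  have hm : Complex.log z = Complex.log (1 - w) + Complex.log c := by
    rw [← log_mul_of_re_pos (by simp; linarith) hcre]
    congr 1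
    rw [sub_mul, hw]
    field_simp
    rw [hc]
    ring
  have hs : HasSum (fun k : ℕ => (w ^ 2) ^ k / (2 * k + 1))
      (c * (Complex.log (z + 1) - Complex.log z)) := by
    rw [hp, hm, add_sub_add_right_eq_sub]
    refine ((hasSum_log_sub_log hw1).mul_left c).congr_fun fun k => ?_
    have hcw : c * (2 * w) = 1 := by rw [hw]; field_simp
    rw [← pow_mul, pow_succ]
    linear_combination (-((w ^ 2) ^ k / (2 * k + 1))) * hcw
  refine (norm_sub_le_of_hasSum hw1 hs).trans (le_of_eq ?_)
  rw [hwn, hN]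
  have : z.re * (z.re + 1) + z.im ^ 2 ≠ 0 := hD.ne'
  have : z.re * (z.re + 1) + z.im ^ 2 + 1 / 4 ≠ 0 := by positivity
  generalize z.re * (z.re + 1) + z.im ^ 2 = D at *
  have : 4 * (D + 1 / 4) - 1 ≠ 0 := by intro h; apply hD.ne'; linarith
  have : 1 - 1 / (4 * (D + 1 / 4)) ≠ 0 := by
    rw [one_sub_div (by positivity)]
    exact div_ne_zero ‹_› (by positivity)
  field_simp
  ring

/-! ### The bound for complex arguments. -/

theorem sub_cube_div_three_le_arctan {u : ℝ} (hu : 0 ≤ u) : u - u ^ 3 / 3 ≤ Real.arctan u := by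
  have hd : ∀ x : ℝ, HasDerivAt (fun x => Real.arctan x - (x - x ^ 3 / 3))
      (1 / (1 + x ^ 2) - (1 - 3 * x ^ 2 / 3)) x := fun x => by
    have := (Real.hasDerivAt_arctan x).sub ((hasDerivAt_id x).sub ((hasDerivAt_pow 3 x).div_const 3))
    exact_mod_cast this
  have hm : Monotone fun x : ℝ => Real.arctan x - (x - x ^ 3 / 3) :=
    monotone_of_hasDerivAt_nonneg hd fun x => by
      have : 1 / (1 + x ^ 2) - (1 - 3 * x ^ 2 / 3) = x ^ 4 / (1 + x ^ 2) := by field_simp; ring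
      simp only [this]
      positivity
  have := hm hu
  simp at this
  linarith

theorem arctan_div_sub_arctan_div {x t : ℝ} (hx : 0 < x) :
    Real.arctan (t / x) - Real.arctan (t / (x + 1)) =
      Real.arctan (t / (x * (x + 1) + t ^ 2)) := by
  have h : t / x * (-(t / (x + 1))) < 1 := by
    have : 0 ≤ t ^ 2 / (x * (x + 1)) := by positivity
    have : t / x * (-(t / (x + 1))) = - (t ^ 2 / (x * (x + 1))) := by field_simp
    linarith
  rw [sub_eq_add_neg, ← Real.arctan_neg, Real.arctan_add h]
  congr 1
  have : x * (x + 1) + t ^ 2 ≠ 0 := by positivity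
  have : 1 - t / x * -(t / (x + 1)) = (x * (x + 1) + t ^ 2) / (x * (x + 1)) := by field_simp; ring
  rw [this]
  field_simp
  ring

/-- The arctangent difference is `arctan u` with `u = t/D`. Since `D ≥ 2 + t²`, `u² ≤ 1/8`, hence
`arctan u ≥ (1 - 1/24) u`; the constant is `2/23 = (1/12)/(23/24)`. -/
theorem one_div_le_arctan_sub_arctan {x t : ℝ} (hx : 1 ≤ x) (ht : 0 < t) :
    1 / (12 * (x * (x + 1) + t ^ 2)) ≤
      2 / (23 * t) * Real.arctan (t / x) - 2 / (23 * t) * Real.arctan (t / (x + 1)) := by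
  rw [← mul_sub, arctan_div_sub_arctan_div (by linarith)]
  set D := x * (x + 1) + t ^ 2 with hD
  have hD2 : 2 + t ^ 2 ≤ D := by nlinarith
  have hD0 : 0 < D := by positivity
  have hu : (t / D) ^ 2 ≤ 1 / 8 := by
    rw [div_pow, div_le_div_iff₀ (by positivity) (by norm_num)]
    nlinarith [sq_nonneg (t ^ 2 - 2)]
  have hu0 : 0 < t / D := by positivity
  have h1 := sub_cube_div_three_le_arctan hu0.le
  have h2 : 23 / 24 * (t / D) ≤ Real.arctan (t / D) := by nlinarith
  calc 1 / (12 * D) = 2 / (23 * t) * (23 / 24 * (t / D)) := by field_simp; norm_num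
    _ ≤ _ := by gcongr

theorem abs_binetRe_le_of_telescope {z : ℂ} (hz : 0 < z.re) {G : ℝ → ℝ}
    (hG : Tendsto (fun n : ℕ => G (z.re + n)) atTop (𝓝 0))
    (h : ∀ x, z.re ≤ x → 1 / (12 * (x * (x + 1) + z.im ^ 2)) ≤ G x - G (x + 1)) :
    |binetRe z| ≤ G z.re := by
  have hb : ∀ n : ℕ, |binetRe (z + n) - binetRe (z + (n + 1 : ℕ))| ≤
      G (z.re + n) - G (z.re + (n + 1 : ℕ)) := fun n => by
    have hn : (0 : ℝ) ≤ n := n.cast_nonneg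
    have hre : 0 < (z + n).re := by simp; linarith
    have h1 := h (z.re + n) (by linarith)
    have h2 := norm_add_half_mul_log_sub_one_le hre
    push_cast
    rw [← add_assoc, ← add_assoc, binetRe_sub_add_one hre]
    refine (Complex.abs_re_le_norm _).trans (h2.trans ?_)
    simpa using h1
  have ht := tendsto_binetRe_add_natCast hz
  have h1 := le_of_sub_succ_le ht hG fun n => (abs_le.1 (hb n)).2
  have h2 := le_of_sub_succ_le (by simpa using ht.neg) hG fun n => by
    have := (abs_le.1 (hb n)).1
    linarith
  simp only [Nat.cast_zero, add_zero] at h1 h2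
  exact abs_le.2 ⟨by linarith, h1⟩

theorem tendsto_const_div_add_natCast (b x : ℝ) :
    Tendsto (fun n : ℕ => b / (x + n)) atTop (𝓝 0) :=
  tendsto_const_nhds.div_atTop (tendsto_atTop_add_const_left _ _ tendsto_natCast_atTop_atTop)

/-- Jordan's inequality `sin θ ≥ 2θ/π` at `θ = arctan (t/x)`. -/
theorem arctan_div_le {x t : ℝ} (hx : 0 < x) (ht : 0 < t) :
    Real.arctan (t / x) / t ≤ Real.pi / 2 / √(x ^ 2 + t ^ 2) := by
  have h := Real.mul_le_sin (Real.arctan_nonneg.2 (by positivity : 0 ≤ t / x))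
    (Real.arctan_lt_pi_div_two _).le
  have h1 : Real.sin (Real.arctan (t / x)) = t / √(x ^ 2 + t ^ 2) := by
    have : √(x ^ 2 + t ^ 2) = x * √(1 + (t / x) ^ 2) := by
      rw [← Real.sqrt_sq hx.le, ← Real.sqrt_mul (by positivity), Real.sqrt_sq hx.le]
      congr 1
      field_simp
    rw [Real.sin_arctan, this]
    field_simp
  rw [h1] at h
  have hs : 0 < √(x ^ 2 + t ^ 2) := by positivity
  rw [div_le_iff₀ ht]
  calc Real.arctan (t / x) = Real.pi / 2 * (2 / Real.pi * Real.arctan (t / x)) := by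
        field_simp
    _ ≤ Real.pi / 2 * (t / √(x ^ 2 + t ^ 2)) := by gcongr
    _ = _ := by ring

theorem abs_binetRe_le {z : ℂ} (hz : 1 ≤ z.re) : |binetRe z| ≤ Real.pi / 23 / ‖z‖ := by
  have hz0 : 0 < z.re := by linarith
  have hn : ‖z‖ = √(z.re ^ 2 + z.im ^ 2) := by
    rw [Complex.norm_def, Complex.normSq_apply, sq, sq]
  rcases eq_or_ne z.im 0 with h0 | h0
  -- The arctangent comparison divides by `|z.im|`; on the real axis its role is played by
  -- `1/(12x)`, which telescopes exactly.
  · have h1 := abs_binetRe_le_of_telescope hz0 (G := fun x => 1 / 12 / x)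
      (tendsto_const_div_add_natCast _ _) (fun x hx => le_of_eq (by
        have : x ≠ 0 := by linarith
        have : x + 1 ≠ 0 := by linarith
        rw [h0]
        field_simp
        ring))
    refine h1.trans ?_
    rw [hn, h0, zero_pow two_ne_zero, add_zero, Real.sqrt_sq hz0.le]
    have := Real.pi_gt_three
    exact div_le_div_of_nonneg_right (by linarith) hz0.le
  · have ht : 0 < |z.im| := abs_pos.2 h0
    have h1 := abs_binetRe_le_of_telescope hz0
      (G := fun x => 2 / (23 * |z.im|) * Real.arctan (|z.im| / x))
      (by
        have := ((Real.continuous_arctan.tendsto 0).comp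
          (tendsto_const_div_add_natCast |z.im| z.re)).const_mul (2 / (23 * |z.im|))
        simpa [Function.comp_def] using this)
      (fun x hx => by simpa using one_div_le_arctan_sub_arctan (hz.trans hx) ht)
    refine h1.trans ?_
    have h2 := arctan_div_le hz0 ht
    rw [sq_abs, ← hn] at h2
    calc _ = 2 / 23 * (Real.arctan (|z.im| / z.re) / |z.im|) := by field_simp
      _ ≤ 2 / 23 * (Real.pi / 2 / ‖z‖) := by gcongr
      _ = _ := by ring

/-! ### Sharper two-sided bounds on the real axis. -/

theorem hasSum_add_half_mul_log {x : ℝ} (hx : 0 < x) :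
    HasSum (fun k : ℕ => (1 / (2 * x + 1) ^ 2) ^ k / (2 * k + 1))
      ((x + 1 / 2) * Real.log (1 + x⁻¹)) := by
  convert! (Real.hasSum_log_one_add_inv hx).mul_left (x + 1 / 2) using 1
  ext k
  have h : (x + 1 / 2) * (2 * (1 / (2 * x + 1))) = 1 := by field_simp
  rw [← one_div_pow, ← pow_mul, pow_succ _ (2 * k)]
  linear_combination (-((1 / (2 * x + 1)) ^ (2 * k) / (2 * k + 1))) * h

theorem le_add_half_mul_log_sub_one {x : ℝ} (hx : 0 < x) :
    1 / (3 * (2 * x + 1) ^ 2) + 1 / (5 * (2 * x + 1) ^ 4) ≤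
      (x + 1 / 2) * Real.log (1 + x⁻¹) - 1 := by
  have h := sum_le_hasSum (Finset.range 3) (fun k _ => by positivity) (hasSum_add_half_mul_log hx)
  simp only [Finset.sum_range_succ, Finset.range_zero, Finset.sum_empty] at h
  norm_num at h
  have h1 : 1 / (3 * (2 * x + 1) ^ 2) = ((2 * x + 1) ^ 2)⁻¹ / 3 := by field_simp
  have h2 : 1 / (5 * (2 * x + 1) ^ 4) = (((2 * x + 1) ^ 2) ^ 2)⁻¹ / 5 := by field_simp
  rw [h1, h2]
  norm_num
  linarith

theorem add_half_mul_log_sub_one_le {x : ℝ} (hx : 0 < x) :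
    (x + 1 / 2) * Real.log (1 + x⁻¹) - 1 ≤
      1 / (3 * (2 * x + 1) ^ 2) + 1 / (5 * (2 * x + 1) ^ 4)
        + 1 / (7 * (2 * x + 1) ^ 4 * ((2 * x + 1) ^ 2 - 1)) := by
  set q := (2 * x + 1) ^ 2 with hq
  have hq1 : 1 < q := by rw [hq]; nlinarith
  have h4 : (2 * x + 1) ^ 4 = q ^ 2 := by rw [hq]; ring
  -- From `k = 3` on the denominators `2k + 1` are at least `7`, so a geometric series bounds the
  -- tail.
  have h := (hasSum_nat_add_iff' 3).2 (hasSum_add_half_mul_log hx)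
  have hg : HasSum (fun k : ℕ => 1 / (7 * q ^ 3) * (1 / q) ^ k)
      (1 / (7 * q ^ 3) * (1 - 1 / q)⁻¹) :=
    (hasSum_geometric_of_lt_one (by positivity) ((div_lt_one (by linarith)).2 hq1)).mul_left _
  have hle := hasSum_le (fun k => ?_) h hg
  · simp only [Finset.sum_range_succ, Finset.range_zero, Finset.sum_empty] at hle
    have e : 1 / (7 * q ^ 3) * (1 - 1 / q)⁻¹ = 1 / (7 * q ^ 2 * (q - 1)) := by
      have : q - 1 ≠ 0 := by linarith
      have : q ≠ 0 := by linarith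
      rw [one_sub_div this]
      field_simp
    rw [e] at hle
    rw [h4]
    have e1 : 1 / (3 * q) = (1 / q) ^ 1 / 3 := by field_simp
    have e2 : 1 / (5 * q ^ 2) = (1 / q) ^ 2 / 5 := by field_simp
    rw [e1, e2]
    norm_num at hle ⊢
    linarith
  · rw [← hq, pow_add, mul_comm ((1 / q) ^ k), mul_div_right_comm]
    have : (1 / q) ^ 3 / (2 * ((k + 3 : ℕ) : ℝ) + 1) ≤ 1 / (7 * q ^ 3) := by
      rw [one_div_pow, div_div, mul_comm 7]
      gcongr
      push_cast
      linarith [(k.cast_nonneg : (0 : ℝ) ≤ k)]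
    gcongr

theorem binetRe_ofReal_sub_add_one {x : ℝ} (hx : 0 < x) :
    binetRe x - binetRe (x + 1 : ℝ) = (x + 1 / 2) * Real.log (1 + x⁻¹) - 1 := by
  have h := binetRe_sub_add_one (z := (x : ℂ)) (by simpa using hx)
  have e : (x : ℂ) + 1 = ((x + 1 : ℝ) : ℂ) := by push_cast; rfl
  have e2 : ((x : ℂ) + 1 / 2) = ((x + 1 / 2 : ℝ) : ℂ) := by push_cast; rfl
  have e3 : 1 + x⁻¹ = (x + 1) / x := by field_simp
  rw [e3, Real.log_div (by positivity) hx.ne', ← Complex.ofReal_one] at *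
  rw [e, e2, ← Complex.ofReal_log hx.le, ← Complex.ofReal_log (by positivity),
    ← Complex.ofReal_sub, ← Complex.ofReal_mul, ← Complex.ofReal_sub, Complex.ofReal_re] at h
  exact h

theorem tendsto_binetRe_ofReal_add_natCast {x : ℝ} (hx : 0 < x) :
    Tendsto (fun n : ℕ => binetRe ((x + n : ℝ) : ℂ)) atTop (𝓝 0) := by
  simpa using tendsto_binetRe_add_natCast (z := (x : ℂ)) (by simpa using hx)

theorem binetRe_ofReal_le_of_telescope {x : ℝ} (hx : 0 < x) {G : ℝ → ℝ}
    (hG : Tendsto (fun n : ℕ => G (x + n)) atTop (𝓝 0))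
    (h : ∀ y, x ≤ y → (y + 1 / 2) * Real.log (1 + y⁻¹) - 1 ≤ G y - G (y + 1)) :
    binetRe x ≤ G x := by
  have := le_of_sub_succ_le (tendsto_binetRe_ofReal_add_natCast hx) hG fun n => by
    have hn : (0 : ℝ) ≤ n := n.cast_nonneg
    have := h (x + n) (by linarith)
    rw [← binetRe_ofReal_sub_add_one (by positivity)] at this
    simpa [add_assoc] using this
  simpa using this

theorem le_binetRe_ofReal_of_telescope {x : ℝ} (hx : 0 < x) {G : ℝ → ℝ}
    (hG : Tendsto (fun n : ℕ => G (x + n)) atTop (𝓝 0))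
    (h : ∀ y, x ≤ y → G y - G (y + 1) ≤ (y + 1 / 2) * Real.log (1 + y⁻¹) - 1) :
    G x ≤ binetRe x := by
  have := le_of_sub_succ_le hG (tendsto_binetRe_ofReal_add_natCast hx) fun n => by
    have hn : (0 : ℝ) ≤ n := n.cast_nonneg
    have := h (x + n) (by linarith)
    rw [← binetRe_ofReal_sub_add_one (by positivity)] at this
    simpa [add_assoc] using this
  simpa using this

theorem log_one_add_le_binetRe {x : ℝ} (hx : 1 ≤ x) :
    Real.log (1 + 1 / (6 * x)) / 2 ≤ binetRe x := by
  have hx0 : 0 < x := by linarith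
  refine le_binetRe_ofReal_of_telescope hx0 (G := fun x => Real.log (1 + 1 / (6 * x)) / 2) ?_ ?_
  · have h0 : Tendsto (fun n : ℕ => 1 + 1 / (6 * (x + n))) atTop (𝓝 1) := by
      have : Tendsto (fun n : ℕ => 1 / (6 * (x + n))) atTop (𝓝 0) :=
        tendsto_const_nhds.div_atTop ((tendsto_atTop_add_const_left _ _
          tendsto_natCast_atTop_atTop).const_mul_atTop (by norm_num))
      simpa using this.const_add 1
    simpa using (h0.log one_ne_zero).div_const 2
  · intro y hy
    have hy1 : 1 ≤ y := hx.trans hy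
    refine le_trans ?_ (le_add_half_mul_log_sub_one (by linarith))
    rw [← sub_div, ← Real.log_div (by positivity) (by positivity)]
    have h1 := Real.log_le_sub_one_of_pos
      (x := (1 + 1 / (6 * y)) / (1 + 1 / (6 * (y + 1)))) (by positivity)
    have h2 : (1 + 1 / (6 * y)) / (1 + 1 / (6 * (y + 1))) - 1 = 1 / (y * (6 * y + 7)) := by
      field_simp
      ring
    rw [h2] at h1
    have h3 : 1 / (y * (6 * y + 7)) / 2 ≤
        1 / (3 * (2 * y + 1) ^ 2) + 1 / (5 * (2 * y + 1) ^ 4) := by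
      rw [div_div, div_add_div _ _ (by positivity) (by positivity),
        div_le_div_iff₀ (by positivity) (by positivity)]
      -- Shifted to the endpoint `y = 1`, the polynomial has only nonnegative coefficients.
      obtain ⟨v, rfl⟩ : ∃ v, y = 1 + v := ⟨y - 1, by ring⟩
      have hv : 0 ≤ v := by linarith
      rw [← sub_nonneg]
      ring_nf
      positivity
    linarith

/-- The cubic correction is needed because `1/12` exceeds `log 1.177 / 2`, so `1/(12x)` alone is too
large at `x = 1`. The coefficient `0.0022` stays below the asymptotic `1/360`, which leaves room for
the comparison down to `y = 1`. -/
theorem binetRe_le_inv_sub {x : ℝ} (hx : 1 ≤ x) :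
    binetRe x ≤ 1 / (12 * x) - 0.0022 / x ^ 3 := by
  have hx0 : 0 < x := by linarith
  refine binetRe_ofReal_le_of_telescope hx0 (G := fun x => 1 / (12 * x) - 0.0022 / x ^ 3) ?_ ?_
  · have hT : Tendsto (fun n : ℕ => x + n) atTop atTop :=
      tendsto_atTop_add_const_left _ _ tendsto_natCast_atTop_atTop
    have h1 : Tendsto (fun n : ℕ => 1 / (12 * (x + n))) atTop (𝓝 0) :=
      tendsto_const_nhds.div_atTop (hT.const_mul_atTop (by norm_num))
    have h2 : Tendsto (fun n : ℕ => 0.0022 / (x + n) ^ 3) atTop (𝓝 0) :=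
      tendsto_const_nhds.div_atTop ((tendsto_pow_atTop three_ne_zero).comp hT)
    simpa using h1.sub h2
  · intro y hy
    have hy1 : 1 ≤ y := hx.trans hy
    have hy0 : 0 < y := by linarith
    refine (add_half_mul_log_sub_one_le hy0).trans ?_
    obtain ⟨q, hq⟩ : ∃ q, q = y * (y + 1) := ⟨_, rfl⟩
    have hq2 : 2 ≤ q := by nlinarith
    have e1 : (2 * y + 1) ^ 2 = 4 * q + 1 := by rw [hq]; ring
    have e2 : (2 * y + 1) ^ 4 = (4 * q + 1) ^ 2 := by rw [← e1]; ring
    have e3 : 1 / (12 * y) - 0.0022 / y ^ 3 - (1 / (12 * (y + 1)) - 0.0022 / (y + 1) ^ 3) =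
        1 / (12 * q) - 0.0022 * (3 * q + 1) / q ^ 3 := by
      rw [hq]
      field_simp
      ring
    rw [e1, e2, e3, ← sub_nonneg]
    obtain ⟨v, rfl⟩ : ∃ v, q = 2 + v := ⟨q - 2, by ring⟩
    have hv : 0 ≤ v := by linarith
    have h0 : 4 * (2 + v) + 1 - 1 = 4 * (2 + v) := by ring
    rw [h0]
    have : 1 / (12 * (2 + v)) - 0.0022 * (3 * (2 + v) + 1) / (2 + v) ^ 3 -
        (1 / (3 * (4 * (2 + v) + 1)) + 1 / (5 * (4 * (2 + v) + 1) ^ 2)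
          + 1 / (7 * (4 * (2 + v) + 1) ^ 2 * (4 * (2 + v)))) =
        (1 / 12 * (2 + v) ^ 2 * (9 + 4 * v) ^ 2 - 0.0022 * (7 + 3 * v) * (9 + 4 * v) ^ 2
          - (2 + v) ^ 3 * (9 + 4 * v) / 3 - (2 + v) ^ 3 / 5 - (2 + v) ^ 2 / 28)
          / ((2 + v) ^ 3 * (9 + 4 * v) ^ 2) := by
      have : 4 * (2 + v) + 1 = 9 + 4 * v := by ring
      rw [this]
      field_simp
      ring
    rw [this]
    apply div_nonneg _ (by positivity)
    ring_nf
    positivity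

theorem binetRe_le_log_one_add {x : ℝ} (hx : 1 ≤ x) :
    binetRe x ≤ Real.log (1 + 0.177 / x) / 2 := by
  have hx0 : 0 < x := by linarith
  refine (binetRe_le_inv_sub hx).trans ?_
  have h := Real.le_log_one_add_of_nonneg (x := 0.177 / x) (by positivity)
  have h2 : 2 * (1 / (12 * x) - 0.0022 / x ^ 3) ≤ 2 * (0.177 / x) / (0.177 / x + 2) := by
    have e1 : 2 * (1 / (12 * x) - 0.0022 / x ^ 3) = (x ^ 2 / 6 - 0.0044) / x ^ 3 := by
      field_simp
      ring
    have e2 : 2 * (0.177 / x) / (0.177 / x + 2) = 0.354 / (0.177 + 2 * x) := by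
      field_simp
      ring
    rw [e1, e2, div_le_div_iff₀ (by positivity) (by positivity)]
    obtain ⟨v, rfl⟩ : ∃ v, x = 1 + v := ⟨x - 1, by ring⟩
    have hv : 0 ≤ v := by linarith
    rw [← sub_nonneg]
    ring_nf
    positivity
  linarith

/-! ### Factoring `γ` into `γ*` and Binet remainders. -/

theorem arg_eq_arctan {z : ℂ} (hz : 0 < z.re) : Complex.arg z = Real.arctan (z.im / z.re) := by
  have h := abs_lt.1 (Complex.abs_arg_lt_pi_div_two_iff.2 (Or.inl hz))
  rw [← Complex.tan_arg, Real.arctan_tan h.1 h.2]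

theorem log_norm_Gamma (z : ℂ) : Real.log ‖Complex.Gamma z‖ =
    binetRe z + ((z.re - 1 / 2) * Real.log ‖z‖ - z.im * Complex.arg z - z.re)
      + Real.log (2 * Real.pi) / 2 := by
  simp [binetRe, Complex.log_re, Complex.log_im]
  ring

theorem log_Gamma_eq {x : ℝ} (hx : 0 < x) : Real.log (Real.Gamma x) =
    binetRe x + ((x - 1 / 2) * Real.log x - x) + Real.log (2 * Real.pi) / 2 := by
  have h := log_norm_Gamma (x : ℂ)
  rw [Complex.Gamma_ofReal, Complex.norm_of_nonneg (Real.Gamma_pos_of_pos hx).le,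
    Complex.norm_of_nonneg hx.le, Complex.arg_ofReal_of_nonneg hx.le] at h
  simpa using h

theorem log_gammaConst {a s : ℝ} (ha : 1 / 2 < a) :
    Real.log (gammaConst a s) =
      2 * Real.log ‖Complex.Gamma ((a : ℂ) - Complex.I * s / 2)‖ - Real.log (Real.Gamma a)
        - Real.log (Real.Gamma (a + 1 / 2)) + Real.log (a - 1 / 2) - Real.log Real.pi / 2 := by
  have hb : 0 < a - 1 / 2 := by linarith
  have h1 := Real.Gamma_pos_of_pos (by linarith : 0 < a)
  have h2 := Real.Gamma_pos_of_pos hb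
  have hz : Complex.Gamma ((a : ℂ) - Complex.I * s / 2) ≠ 0 :=
    Complex.Gamma_ne_zero_of_re_pos (by simp; linarith)
  have h3 : Real.Gamma (a + 1 / 2) = (a - 1 / 2) * Real.Gamma (a - 1 / 2) := by
    rw [← Real.Gamma_add_one hb.ne']
    congr 1
    ring
  have hpi := Real.pi_pos
  rw [gammaConst, h3, Real.Gamma_one_half_eq, Real.log_div (by positivity) (by positivity),
    Real.log_pow, Real.log_mul (by positivity) (by positivity), Real.log_mul h1.ne' h2.ne',
    Real.log_mul hb.ne' h2.ne', Real.log_sqrt hpi.le]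
  push_cast
  ring

theorem log_gammaStar {a s : ℝ} (ha : 1 / 2 < a) :
    Real.log (gammaStar a s) =
      Real.log (a - 1 / 2) + (a - 1 / 2) * Real.log (1 + (s / (2 * a)) ^ 2)
        - s * Real.arctan (s / (2 * a)) - (Real.log Real.pi - 1) / 2
        - a * (Real.log (a + 1 / 2) - Real.log a) - Real.log a / 2 := by
  have ha0 : 0 < a := by linarith
  have hb : 0 < a - 1 / 2 := by linarith
  have hpi := Real.pi_pos
  have hc : 0 < (1 + (s / (2 * a)) ^ 2) := by positivity
  have hd : 1 + 1 / (2 * a) = (a + 1 / 2) / a := by field_simp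
  have hd0 : 0 < (a + 1 / 2) / a := by positivity
  rw [gammaStar, hd, Real.log_div (by positivity) (by positivity),
    Real.log_mul (by positivity) (by positivity), Real.log_mul (by positivity) (by positivity),
    Real.log_mul (by positivity) (by positivity), Real.log_mul (by positivity) (by positivity),
    Real.log_sqrt (by positivity), Real.log_sqrt ha0.le, Real.log_div hpi.ne' (by positivity),
    Real.log_rpow hc, Real.log_rpow hd0, Real.log_exp, Real.log_exp,
    Real.log_div (by positivity) ha0.ne']
  ring

theorem norm_sub_I_mul_div_two (a s : ℝ) :
    ‖(a : ℂ) - Complex.I * s / 2‖ = √(a ^ 2 + (s / 2) ^ 2) := by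
  rw [Complex.norm_def, Complex.normSq_apply]
  simp [sq]

theorem gammaStar_pos {a s : ℝ} (ha : 1 / 2 < a) : 0 < gammaStar a s := by
  have : 0 < a := by linarith
  have : 0 < a - 1 / 2 := by linarith
  have := Real.pi_pos
  rw [gammaStar]
  positivity

theorem gammaConst_pos {a s : ℝ} (ha : 1 / 2 < a) : 0 < gammaConst a s := by
  have h1 := Real.Gamma_pos_of_pos (by linarith : 0 < a)
  have h2 := Real.Gamma_pos_of_pos (by linarith : 0 < a - 1 / 2)
  have h3 := Real.Gamma_pos_of_pos (by norm_num : (0 : ℝ) < 1 / 2)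
  have hz : Complex.Gamma ((a : ℂ) - Complex.I * s / 2) ≠ 0 :=
    Complex.Gamma_ne_zero_of_re_pos (by simp; linarith)
  rw [gammaConst]
  positivity

/-- Using `a + 1/2` in place of `a - 1/2` keeps both real arguments at least `1` when `a ≥ 1`, where
the real bounds apply. -/
theorem gammaConst_eq {a s : ℝ} (ha : 1 / 2 < a) :
    gammaConst a s = gammaStar a s *
      (Real.exp (binetRe ((a : ℂ) - Complex.I * s / 2)) ^ 2 *
        (Real.exp (-binetRe a) * Real.exp (-binetRe (a + 1 / 2 : ℝ)))) := by
  have ha0 : 0 < a := by linarith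
  have hS := gammaStar_pos (s := s) ha
  refine Real.log_injOn_pos (gammaConst_pos ha) (Set.mem_Ioi.2 (by positivity)) ?_
  set z : ℂ := (a : ℂ) - Complex.I * s / 2 with hz
  have hre : z.re = a := by simp [hz]
  have him : z.im = -(s / 2) := by simp [hz]
  have harg : Complex.arg z = -Real.arctan (s / (2 * a)) := by
    rw [arg_eq_arctan (by rw [hre]; exact ha0), hre, him, ← Real.arctan_neg]
    congr 1
    field_simp
  have hnorm : Real.log ‖z‖ = Real.log a + Real.log (1 + (s / (2 * a)) ^ 2) / 2 := by
    have : a ^ 2 + (s / 2) ^ 2 = a ^ 2 * (1 + (s / (2 * a)) ^ 2) := by field_simp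
    rw [hz, norm_sub_I_mul_div_two, this, Real.log_sqrt (by positivity),
      Real.log_mul (by positivity) (by positivity), Real.log_pow]
    push_cast
    ring
  rw [Real.log_mul hS.ne' (by positivity), Real.log_mul (by positivity) (by positivity),
    Real.log_mul (by positivity) (by positivity), Real.log_pow, Real.log_exp, Real.log_exp,
    Real.log_exp, log_gammaConst ha, log_gammaStar ha, ← hz, log_norm_Gamma, log_Gamma_eq ha0,
    log_Gamma_eq (by positivity), hre, him, harg, hnorm]
  push_cast
  ring

/-! ### Exponentiating the bounds. -/

theorem exp_neg_le_inv_sqrt {L y : ℝ} (hy : 0 < y) (h : Real.log y / 2 ≤ L) :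
    Real.exp (-L) ≤ (√y)⁻¹ := by
  rw [Real.exp_neg]
  gcongr
  rw [← Real.log_le_iff_le_exp (by positivity), Real.log_sqrt hy.le]
  exact h

theorem inv_sqrt_le_exp_neg {L y : ℝ} (hy : 0 < y) (h : L ≤ Real.log y / 2) :
    (√y)⁻¹ ≤ Real.exp (-L) := by
  rw [Real.exp_neg]
  gcongr
  rw [← Real.le_log_iff_exp_le (by positivity), Real.log_sqrt hy.le]
  exact h

/-- With `d = 3/(2π²)` this says `π/23 ≤ 2d/(d + 2)`, the lower bound used for `log (1 + d)`; it is
the worst case `‖z‖ = 1`. -/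
theorem pi_div_le : Real.pi / 23 * (3 / (2 * Real.pi ^ 2) + 2) ≤ 2 * (3 / (2 * Real.pi ^ 2)) := by
  have h1 := Real.pi_lt_d2
  have h3 : Real.pi ^ 3 ≤ 3.15 ^ 3 := by gcongr
  have e1 : Real.pi / 23 * (3 / (2 * Real.pi ^ 2) + 2) =
    (3 * Real.pi + 4 * Real.pi ^ 3) / (46 * Real.pi ^ 2) := by field_simp; ring
  have e2 : 2 * (3 / (2 * Real.pi ^ 2)) = 138 / (46 * Real.pi ^ 2) := by field_simp; norm_num
  rw [e1, e2]
  gcongr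
  norm_num at h3
  linarith

theorem exp_binetRe_le {z : ℂ} (hz : 1 ≤ z.re) :
    Real.exp (binetRe z) ≤ 1 + 3 / (2 * Real.pi ^ 2 * ‖z‖) := by
  have hr : 1 ≤ ‖z‖ := hz.trans ((le_abs_self _).trans (Complex.abs_re_le_norm z))
  have hr0 : 0 < ‖z‖ := by linarith
  have hpi := Real.pi_pos
  rw [← Real.le_log_iff_exp_le (by positivity), ← div_div]
  set d := 3 / (2 * Real.pi ^ 2) with hd
  have hd0 : 0 < d := by positivity
  refine ((le_abs_self _).trans (abs_binetRe_le hz)).trans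
    (le_trans ?_ (Real.le_log_one_add_of_nonneg (by positivity)))
  rw [le_div_iff₀ (by positivity)]
  have h1 : d / ‖z‖ ≤ d := div_le_self hd0.le hr
  calc Real.pi / 23 / ‖z‖ * (d / ‖z‖ + 2) ≤ Real.pi / 23 / ‖z‖ * (d + 2) := by gcongr
    _ = Real.pi / 23 * (d + 2) / ‖z‖ := by ring
    _ ≤ 2 * d / ‖z‖ := div_le_div_of_nonneg_right pi_div_le hr0.le
    _ = _ := by ring

theorem le_exp_binetRe {z : ℂ} (hz : 1 ≤ z.re) :
    1 - 3 / (2 * Real.pi ^ 2 * ‖z‖) ≤ Real.exp (binetRe z) := by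
  have hr0 : 0 < ‖z‖ :=
    one_pos.trans_le (hz.trans ((le_abs_self _).trans (Complex.abs_re_le_norm z)))
  have hpi := Real.pi_pos
  have h1 := (abs_le.1 (abs_binetRe_le hz)).1
  have h2 := Real.add_one_le_exp (binetRe z)
  have hc : Real.pi / 23 ≤ 3 / (2 * Real.pi ^ 2) := by
    have := pi_div_le
    have : 0 ≤ Real.pi / 23 * (3 / (2 * Real.pi ^ 2)) := by positivity
    linarith
  have h3 : Real.pi / 23 / ‖z‖ ≤ 3 / (2 * Real.pi ^ 2 * ‖z‖) := by
    rw [← div_div 3]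
    gcongr
  linarith

theorem one_sub_nonneg {z : ℂ} (hz : 1 ≤ z.re) : 0 ≤ 1 - 3 / (2 * Real.pi ^ 2 * ‖z‖) := by
  have hr : 1 ≤ ‖z‖ := hz.trans ((le_abs_self _).trans (Complex.abs_re_le_norm z))
  have hpi := Real.pi_gt_three
  rw [sub_nonneg, div_le_one (by positivity)]
  nlinarith

end PearsonIV

theorem mainTheorem1 (a s : ℝ) (ha : 1 ≤ a) (hs : 0 ≤ s) :
    PearsonIV.gammaMinus a s ≤ PearsonIV.gammaConst a s ∧
      PearsonIV.gammaConst a s ≤ PearsonIV.gammaPlus a s := by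
  have ha0 : 0 < a := by linarith
  have ha2 : 1 / 2 < a := by linarith
  have hb : 1 ≤ a + 1 / 2 := by linarith
  have hre : 1 ≤ ((a : ℂ) - Complex.I * s / 2).re := by simpa using ha
  have hS := (PearsonIV.gammaStar_pos (s := s) ha2).le
  rw [PearsonIV.gammaMinus, PearsonIV.gammaPlus, PearsonIV.gammaConst_eq ha2,
    ← PearsonIV.norm_sub_I_mul_div_two, div_eq_mul_inv _ (√(1 + 0.177 / a) * _),
    div_eq_mul_inv _ (√(1 + 1 / (6 * a)) * _), mul_inv, mul_inv]
  -- Squaring the lower bound is monotone only because its base is nonnegative.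
  have h0 := PearsonIV.one_sub_nonneg hre
  constructor
  · gcongr
    · exact PearsonIV.le_exp_binetRe hre
    · exact PearsonIV.inv_sqrt_le_exp_neg (by positivity) (PearsonIV.binetRe_le_log_one_add ha)
    · exact PearsonIV.inv_sqrt_le_exp_neg (by positivity) (PearsonIV.binetRe_le_log_one_add hb)
  · gcongr
    · exact PearsonIV.exp_binetRe_le hre
    · exact PearsonIV.exp_neg_le_inv_sqrt (by positivity) (PearsonIV.log_one_add_le_binetRe ha)
    · exact PearsonIV.exp_neg_le_inv_sqrt (by positivity) (PearsonIV.log_one_add_le_binetRe hb)
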